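/- Let $K$ be a field with $\operatorname{char} K \neq 2,3$. Let $E$ be the Grassmann (exterior) algebra of a $K$-vector space of countably infinite dimension, and for $r \ge 2$ let $E_r$ be the Grassmann algebra of an $r$-dimensional $K$-vector space. Let $s \geq 0$, let $i_1,\dots,i_s \geq 2$ be integers, and let $F = E\otimes_K E_{i_1}\otimes_K \cdots\otimes_K E_{i_s}$ with the usual (ungraded) multiplication $(a_0\otimes\cdots\otimes a_s)(b_0\otimes\cdots\otimes b_s)=a_0b_0\otimes\cdots\otimes a_sb_s$. Write $[x_1]=x_1$, $[a,b]=ab-ba$ and $[x_1,\dots,x_{q+1}]=[[x_1,\dots,x_q],x_{q+1}]$; $F$ satisfies the identity $[x_1,\dots,x_q]=0$ if $[a_1,\dots,a_q]=0$ for all $a_1,\dots,a_q\in F$. (i) For every integer $k \geq 1$: if $F$ does not satisfy the identity $[x_1,\dots,x_{2k+1}]=0$, then $F$ does not satisfy the identity $[x_1,\dots,x_{2k+2}]=0$ either. (ii) Consequently, there is a least integer $q \geq 1$ such that $F$ satisfies the identity $[x_1,\dots,x_q]=0$, and this $q$ is odd. -/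

import Mathlib

open scoped TensorProduct

noncomputable section

/-- The left-normed commutator `[x 1, x 2, …, x q]`, that is `[x 1] = x 1` and
`[x 1, …, x (q + 1)] = [[x 1, …, x q], x (q + 1)]` with `[a, b] = a * b - b * a`.
Only lengths `q ≥ 1` are meaningful; the value at `q = 0` is a convention. -/
def leftNormedCommutator {A : Type*} [Ring A] (x : ℕ → A) : ℕ → A
  | 0 => 0
  | 1 => x 1
  | n + 2 => leftNormedCommutator x (n + 1) * x (n + 2)
      - x (n + 2) * leftNormedCommutator x (n + 1)

/-- The polynomial `[x_1, …, x_q]` in the free unital associative algebra `K⟨X⟩` on the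
countable set of variables `x_0, x_1, x_2, …`. -/
def commutatorPolynomial (K : Type*) [Field K] (q : ℕ) : FreeAlgebra K ℕ :=
  leftNormedCommutator (FreeAlgebra.ι K) q

/-- The unital associative algebra `A` satisfies the identity `f = 0`: the polynomial `f`
vanishes under every substitution of elements of `A` for the variables. -/
def SatisfiesIdentity {K : Type*} [Field K] (A : Type*) [Ring A] [Algebra K A]
    (f : FreeAlgebra K ℕ) : Prop :=
  ∀ a : ℕ → A, FreeAlgebra.lift K a f = 0

/-- The Grassmann algebra `E` over a vector space of countably infinite dimension. -/
abbrev GrassmannE (K : Type*) [Field K] : Type _ :=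
  ExteriorAlgebra K (ℕ →₀ K)

/-- The Grassmann algebra `E_r` over a vector space of dimension `r`. -/
abbrev GrassmannEr (K : Type*) [Field K] (r : ℕ) : Type _ :=
  ExteriorAlgebra K (Fin r → K)

/-- The tensor product of algebras `E ⊗ E_{i_1} ⊗ ⋯ ⊗ E_{i_s}` over `K`
(which is `E` up to isomorphism when `s = 0`), with its usual algebra structure
`(a_0 ⊗ ⋯ ⊗ a_s) (b_0 ⊗ ⋯ ⊗ b_s) = a_0 b_0 ⊗ ⋯ ⊗ a_s b_s`. -/
abbrev GrassmannProduct (K : Type*) [Field K] {s : ℕ} (i : Fin s → ℕ) : Type _ :=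
  GrassmannE K ⊗[K] (PiTensorProduct K fun l : Fin s => GrassmannEr K (i l))

end

/-! Write `F = E ⊗ N`, where `N` is generated by finitely many square-zero elements that pairwise
commute or anticommute. By multilinearity only commutators of monomials `v ⊗ q` matter. In each step
the two products differ by a sign: equal signs kill the commutator, opposite signs double the
product. If the `N`-parts anticommute, the `E`-degrees must not both be odd. If they commute, both
degrees must be odd, so the new degree is even and another commuting step cannot follow.

Hence nonvanishing of `[x_1, …, x_n]` on `F` is equivalent to a nonzero product in `N` of a
`CommutatorSequence` of length `n`; the converse uses fresh generators of `E`. For odd `n` there is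
always room to insert a commuting factor `1`, which gives (i). Anticommuting steps use up generators
and commuting steps are never consecutive, so lengths are bounded and a least `q` exists; (i)
excludes even `q`. -/

section Commutators

/-- `IteratedCommutator S n w` says that `w` is a left-normed commutator of length `n` of elements
of `S`. -/
inductive IteratedCommutator {A : Type*} [Ring A] (S : Set A) : ℕ → A → Prop
  | one {s : A} (hs : s ∈ S) : IteratedCommutator S 1 s
  | step {n : ℕ} {w s : A} (hw : IteratedCommutator S n w) (hs : s ∈ S) :
      IteratedCommutator S (n + 1) (w * s - s * w)

theorem leftNormedCommutator_succ {A : Type*} [Ring A] (x : ℕ → A) {n : ℕ} (hn : 1 ≤ n) :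
    leftNormedCommutator x (n + 1) =
      leftNormedCommutator x n * x (n + 1) - x (n + 1) * leftNormedCommutator x n := by
  obtain ⟨m, rfl⟩ := Nat.exists_eq_add_of_le' hn
  rfl

theorem leftNormedCommutator_congr {A : Type*} [Ring A] {x y : ℕ → A} {n : ℕ}
    (h : ∀ j ≤ n, x j = y j) : leftNormedCommutator x n = leftNormedCommutator y n := by
  induction n with
  | zero => rfl
  | succ n ih =>
    rcases Nat.eq_zero_or_pos n with rfl | hn
    · exact h 1 le_rfl
    · rw [leftNormedCommutator_succ x hn, leftNormedCommutator_succ y hn, h _ le_rfl,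
        ih fun j hj => h j (hj.trans n.le_succ)]

theorem iteratedCommutator_leftNormedCommutator {A : Type*} [Ring A] (x : ℕ → A) {n : ℕ}
    (hn : 1 ≤ n) : IteratedCommutator Set.univ n (leftNormedCommutator x n) := by
  induction n, hn using Nat.le_induction with
  | base => exact .one trivial
  | succ n hn ih =>
    rw [leftNormedCommutator_succ x hn]
    exact ih.step trivial

theorem IteratedCommutator.pos {A : Type*} [Ring A] {S : Set A} {n : ℕ} {w : A}
    (h : IteratedCommutator S n w) : 1 ≤ n := by
  cases h <;> omega

theorem IteratedCommutator.exists_leftNormedCommutator {A : Type*} [Ring A] {S : Set A} {n : ℕ}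
    {w : A} (h : IteratedCommutator S n w) : ∃ x : ℕ → A, leftNormedCommutator x n = w := by
  induction h with
  | one => exact ⟨fun _ => _, rfl⟩
  | @step n w s hw _ ih =>
    obtain ⟨x, hx⟩ := ih
    refine ⟨Function.update x (n + 1) s, ?_⟩
    rw [leftNormedCommutator_succ _ hw.pos, Function.update_self,
      leftNormedCommutator_congr (y := x), hx]
    intro j hj
    exact Function.update_of_ne (by omega) _ _

theorem map_leftNormedCommutator {A B : Type*} [Ring A] [Ring B] (f : A →+* B) (x : ℕ → A)
    (n : ℕ) : f (leftNormedCommutator x n) = leftNormedCommutator (fun j => f (x j)) n := by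
  induction n with
  | zero => exact map_zero f
  | succ n ih =>
    rcases Nat.eq_zero_or_pos n with rfl | hn
    · rfl
    · rw [leftNormedCommutator_succ x hn, leftNormedCommutator_succ _ hn, map_sub, map_mul,
        map_mul, ih]

theorem satisfiesIdentity_commutatorPolynomial_iff {K A : Type*} [Field K] [Ring A] [Algebra K A]
    {n : ℕ} (hn : 1 ≤ n) :
    SatisfiesIdentity A (commutatorPolynomial K n) ↔
      ∀ w, IteratedCommutator (Set.univ : Set A) n w → w = 0 := by
  have key (a : ℕ → A) :
      FreeAlgebra.lift K a (commutatorPolynomial K n) = leftNormedCommutator a n := by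
    have := map_leftNormedCommutator (FreeAlgebra.lift K a).toRingHom (FreeAlgebra.ι K) n
    simpa [commutatorPolynomial] using this
  refine ⟨fun h w hw => ?_, fun h a => ?_⟩
  · obtain ⟨x, rfl⟩ := hw.exists_leftNormedCommutator
    rw [← key, h x]
  · rw [key]
    exact h _ (iteratedCommutator_leftNormedCommutator a hn)

theorem IteratedCommutator.mem_span {K A : Type*} [CommRing K] [Ring A] [Algebra K A] {S : Set A}
    (hS : Submodule.span K S = ⊤) {n : ℕ} {w : A} (h : IteratedCommutator Set.univ n w) :
    w ∈ Submodule.span K {v | IteratedCommutator S n v} := by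
  induction h with
  | @one s _ =>
    have : s ∈ Submodule.span K S := hS ▸ Submodule.mem_top
    exact Submodule.span_mono (fun _ hs => .one hs) this
  | @step n w s _ _ ih =>
    have hs : s ∈ Submodule.span K S := hS ▸ Submodule.mem_top
    have := Submodule.apply_mem_map₂ (LinearMap.mul K A - (LinearMap.mul K A).flip) ih hs
    rw [Submodule.map₂_span_span] at this
    refine Submodule.span_mono ?_ this
    rintro _ ⟨v, hv, t, ht, rfl⟩
    exact IteratedCommutator.step hv ht

theorem exists_iteratedCommutator_ne_zero {K A : Type*} [Field K] [Ring A] [Algebra K A]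
    {S : Set A} (hS : Submodule.span K S = ⊤) {n : ℕ} (hn : 1 ≤ n)
    (h : ¬ SatisfiesIdentity A (commutatorPolynomial K n)) :
    ∃ w, IteratedCommutator S n w ∧ w ≠ 0 := by
  contrapose! h
  rw [satisfiesIdentity_commutatorPolynomial_iff hn]
  intro w hw
  have := hw.mem_span hS
  have hbot : Submodule.span K {v | IteratedCommutator S n v} = ⊥ :=
    Submodule.span_eq_bot.2 fun v hv => h v hv
  rwa [hbot, Submodule.mem_bot] at this

end Commutators

/-! ### Combinatorics of commuting and anticommuting steps. -/

section CommutatorSequences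

/-- `CommutatorSequence n b q` says that `q = y₁ ⋯ yₙ` where each `yⱼ` commutes or anticommutes
with `y₁ ⋯ yⱼ₋₁`, and no two consecutive factors do so by commuting. The flag `b` is `false`
exactly when the last factor was introduced as a commuting one. -/
inductive CommutatorSequence {N : Type*} [Ring N] : ℕ → Bool → N → Prop
  | one (y : N) : CommutatorSequence 1 true y
  | comm {n : ℕ} {q y : N} (hq : CommutatorSequence n true q) (h : q * y = y * q) :
      CommutatorSequence (n + 1) false (q * y)
  | anti {n : ℕ} {b : Bool} {q y : N} (hq : CommutatorSequence n b q) (h : q * y = -(y * q)) :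
      CommutatorSequence (n + 1) true (q * y)

variable {N : Type*} [Ring N]

theorem CommutatorSequence.append_one {n : ℕ} {q : N} (h : CommutatorSequence n true q) :
    CommutatorSequence (n + 1) false q := by
  simpa using h.comm (y := 1) (by simp)

/-- A sequence can be lengthened unless its commuting steps are exactly the ones in even
position. -/
theorem CommutatorSequence.lengthen_or_alternating {n : ℕ} {b : Bool} {q : N}
    (h : CommutatorSequence n b q) :
    CommutatorSequence (n + 1) b q ∨ (b = true ↔ Odd n) := by
  induction h with
  | one => simp
  | comm _ h ih =>
    rcases ih with ih | ih
    · exact .inl (ih.comm h)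
    · exact .inr (by simpa [Nat.odd_add_one] using ih)
  | @anti n b q y hq h ih =>
    rcases ih with ih | ih
    · exact .inl (ih.anti h)
    · cases b
      · exact .inr (by simpa [Nat.odd_add_one] using ih)
      -- Two successive non-commuting positions leave a gap where the factor `1` fits.
      · exact .inl (hq.append_one.anti h)

/-- In the alternating case an odd length forces a final flag `true`, so `1` can be appended at the
end. -/
theorem CommutatorSequence.exists_succ_of_odd {n : ℕ} (hn : Odd n) {b : Bool} {q : N}
    (h : CommutatorSequence n b q) : ∃ b', CommutatorSequence (n + 1) b' q := by
  rcases h.lengthen_or_alternating with h' | h'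
  · exact ⟨b, h'⟩
  · obtain rfl := h'.2 hn
    exact ⟨false, h.append_one⟩

end CommutatorSequences

/-! ### Monomials in generators that commute up to sign. -/

section SignCommutation

/-- Two ring elements commute or anticommute. -/
def SignCommute {N : Type*} [Ring N] (a b : N) : Prop :=
  a * b = b * a ∨ a * b = -(b * a)

variable {N : Type*} [Ring N]

theorem SignCommute.symm {a b : N} (h : SignCommute a b) : SignCommute b a := by
  rcases h with h | h
  · exact .inl h.symm
  · exact .inr (by rw [h, neg_neg])

theorem SignCommute.mul_right {a b c : N} (hb : SignCommute a b) (hc : SignCommute a c) :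
    SignCommute a (b * c) := by
  unfold SignCommute
  rw [← mul_assoc, mul_assoc b c a]
  rcases hb with hb | hb <;> rcases hc with hc | hc <;> simp [hb, mul_assoc, hc]

theorem SignCommute.list_prod_right {a : N} {l : List N} (h : ∀ b ∈ l, SignCommute a b) :
    SignCommute a l.prod := by
  induction l with
  | nil => exact .inl (by simp)
  | cons b l ih =>
    rw [List.prod_cons]
    exact (h b (by simp)).mul_right (ih fun c hc => h c (by simp [hc]))

variable {κ : Type*} {g : κ → N}

theorem SignCommute.list_map_prod (hg : ∀ j k, SignCommute (g j) (g k)) (l m : List κ) :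
    SignCommute (l.map g).prod (m.map g).prod := by
  refine SignCommute.list_prod_right fun b hb => ?_
  obtain ⟨k, -, rfl⟩ := List.mem_map.1 hb
  refine (SignCommute.list_prod_right fun c hc => ?_).symm
  obtain ⟨j, -, rfl⟩ := List.mem_map.1 hc
  exact hg k j

theorem mul_list_prod_eq_zero_of_mem (hg : ∀ j k, SignCommute (g j) (g k))
    (hsq : ∀ k, g k * g k = 0) {k : κ} {l : List κ} (hk : k ∈ l) : g k * (l.map g).prod = 0 := by
  induction l with
  | nil => simp at hk
  | cons j l ih =>
    rw [List.map_cons, List.prod_cons, ← mul_assoc]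
    rcases List.mem_cons.1 hk with rfl | hk
    · rw [hsq, zero_mul]
    · rcases hg k j with h | h <;> rw [h] <;> simp [mul_assoc, ih hk]

theorem nodup_of_list_prod_ne_zero (hg : ∀ j k, SignCommute (g j) (g k))
    (hsq : ∀ k, g k * g k = 0) {l : List κ} (hl : (l.map g).prod ≠ 0) : l.Nodup := by
  induction l with
  | nil => simp
  | cons j l ih =>
    rw [List.map_cons, List.prod_cons] at hl
    refine List.nodup_cons.2 ⟨fun hj => hl (mul_list_prod_eq_zero_of_mem hg hsq hj), ih ?_⟩
    exact right_ne_zero_of_mul hl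

theorem span_range_list_prod {K : Type*} [CommRing K] [Algebra K N]
    (hgen : Algebra.adjoin K (Set.range g) = ⊤) :
    Submodule.span K (Set.range fun l : List κ => (l.map g).prod) = ⊤ := by
  rw [← top_le_iff, ← Algebra.top_toSubmodule, ← hgen, Algebra.adjoin_eq_span]
  refine Submodule.span_mono fun x hx => ?_
  obtain ⟨l, hl, rfl⟩ := Submonoid.exists_list_of_mem_closure hx
  obtain ⟨m, rfl⟩ : l ∈ Set.range (List.map g) := by
    rw [Set.range_list_map]
    exact hl
  exact ⟨m, rfl⟩

end SignCommutation

/-! ### Signs and nonzero products in the Grassmann algebra. -/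

section Exterior

variable {K M : Type*} [CommRing K] [AddCommGroup M] [Module K M]

theorem ExteriorAlgebra.ι_mul_ι_eq_neg (v w : M) :
    ExteriorAlgebra.ι K v * ExteriorAlgebra.ι K w =
      -(ExteriorAlgebra.ι K w * ExteriorAlgebra.ι K v) :=
  eq_neg_of_add_eq_zero_left (ExteriorAlgebra.ι_add_mul_swap v w)

theorem ExteriorAlgebra.list_prod_mul_ι (l : List M) (v : M) :
    (l.map (ExteriorAlgebra.ι K)).prod * ExteriorAlgebra.ι K v =
      (-1 : K) ^ l.length • (ExteriorAlgebra.ι K v * (l.map (ExteriorAlgebra.ι K)).prod) := by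
  induction l with
  | nil => simp
  | cons w l ih =>
    rw [List.map_cons, List.prod_cons, mul_assoc, ih, mul_smul_comm, ← mul_assoc,
      ExteriorAlgebra.ι_mul_ι_eq_neg w v, List.length_cons, pow_succ]
    simp [mul_assoc]

theorem ExteriorAlgebra.list_prod_mul_list_prod (l m : List M) :
    (l.map (ExteriorAlgebra.ι K)).prod * (m.map (ExteriorAlgebra.ι K)).prod =
      (-1 : K) ^ (l.length * m.length) •
        ((m.map (ExteriorAlgebra.ι K)).prod * (l.map (ExteriorAlgebra.ι K)).prod) := by
  induction m with
  | nil => simp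
  | cons w m ih =>
    rw [List.map_cons, List.prod_cons, ← mul_assoc, ExteriorAlgebra.list_prod_mul_ι,
      smul_mul_assoc, mul_assoc, ih, mul_smul_comm, smul_smul, ← pow_add, List.length_cons,
      mul_assoc, mul_add, mul_one, add_comm]

variable (K) in
/-- The product `e₀ e₁ ⋯ eₘ₋₁` of the first `m` generators of the Grassmann algebra on a space
with basis `e₀, e₁, …`. -/
noncomputable def generatorProduct (m : ℕ) : ExteriorAlgebra K (ℕ →₀ K) :=
  ((List.range m).map fun j => ExteriorAlgebra.ι K (Finsupp.single j 1)).prod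

theorem generatorProduct_succ (m : ℕ) :
    generatorProduct K (m + 1) =
      generatorProduct K m * ExteriorAlgebra.ι K (Finsupp.single m 1) := by
  simp [generatorProduct, List.range_succ]

theorem generatorProduct_mul_ι (m : ℕ) (v : ℕ →₀ K) :
    generatorProduct K m * ExteriorAlgebra.ι K v =
      (-1 : K) ^ m • (ExteriorAlgebra.ι K v * generatorProduct K m) := by
  have := ExteriorAlgebra.list_prod_mul_ι (K := K)
    ((List.range m).map fun j => Finsupp.single j (1 : K)) v
  simpa [generatorProduct, Function.comp_def] using this

theorem contractRight_generatorProduct {m j : ℕ} (h : j ≤ m) :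
    CliffordAlgebra.contractRight (Q := (0 : QuadraticForm K (ℕ →₀ K)))
      (generatorProduct K j) (Finsupp.lapply m) = 0 := by
  induction j with
  | zero => exact CliffordAlgebra.contractRight_one (Q := (0 : QuadraticForm K (ℕ →₀ K))) _
  | succ j ih =>
    rw [generatorProduct_succ]
    refine (CliffordAlgebra.contractRight_mul_ι _ _ _).trans ?_
    rw [ih (by omega), Finsupp.lapply_apply, Finsupp.single_eq_of_ne (by omega), zero_smul]
    simp

/-- Contraction with the `m`-th coordinate functional strips the last generator from
`generatorProduct K (m + 1)`. -/
theorem generatorProduct_ne_zero [Nontrivial K] (m : ℕ) : generatorProduct K m ≠ 0 := by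
  induction m with
  | zero => simp [generatorProduct]
  | succ m ih =>
    intro h
    have key := CliffordAlgebra.contractRight_mul_ι (Q := (0 : QuadraticForm K (ℕ →₀ K)))
      (Finsupp.lapply m) (Finsupp.single m 1) (generatorProduct K m)
    rw [contractRight_generatorProduct le_rfl] at key
    change CliffordAlgebra.contractRight (Q := (0 : QuadraticForm K (ℕ →₀ K)))
      (generatorProduct K m * ExteriorAlgebra.ι K (Finsupp.single m 1)) (Finsupp.lapply m) = _
      at key
    rw [← generatorProduct_succ, h] at key
    apply ih
    simpa using key.symm

end Exterior

theorem TensorProduct.tmul_ne_zero_of_field {K V W : Type*} [Field K] [AddCommGroup V] [Module K V]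
    [AddCommGroup W] [Module K W] {v : V} {w : W} (hv : v ≠ 0) (hw : w ≠ 0) :
    v ⊗ₜ[K] w ≠ 0 := by
  obtain ⟨f, hf⟩ : ∃ f : Module.Dual K V, f v ≠ 0 := by
    by_contra! h
    exact hv ((Module.forall_dual_apply_eq_zero_iff K v).1 h)
  obtain ⟨f', hf'⟩ : ∃ f' : Module.Dual K W, f' w ≠ 0 := by
    by_contra! h
    exact hw ((Module.forall_dual_apply_eq_zero_iff K w).1 h)
  intro h
  have := congrArg (LinearMap.mul' K K ∘ₗ TensorProduct.map f f') h
  simp [hf, hf'] at this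

/-! ### Commutators in `E ⊗ N` versus commutator sequences in `N`. -/

section TensorWithGrassmann

variable {K N : Type*} [Field K] [Ring N] [Algebra K N]

/-- Each commutator sequence in `N` with nonzero product yields a nonzero commutator
in `E ⊗ N`. -/
theorem CommutatorSequence.exists_iteratedCommutator {n : ℕ} {b : Bool} {q : N}
    (h : CommutatorSequence n b q) :
    ∃ m : ℕ, (Odd m ↔ b = true) ∧
      IteratedCommutator (Set.univ : Set (GrassmannE K ⊗[K] N)) n
        ((2 : K) ^ (n - 1) • (generatorProduct K m ⊗ₜ[K] q)) := by
  induction h with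
  | one y =>
    exact ⟨1, by simp, by simpa using .one trivial⟩
  | @comm n q y hq h ih =>
    obtain ⟨m, hm, hc⟩ := ih
    obtain ⟨n, rfl⟩ := Nat.exists_eq_add_of_le' hc.pos
    have hm : Odd m := hm.2 rfl
    refine ⟨m + 1, by simpa [Nat.odd_add_one] using hm, ?_⟩
    -- With `m` odd, the fresh generator anticommutes with the `E`-part, so the two products add up.
    convert hc.step (s := ExteriorAlgebra.ι K (Finsupp.single m 1) ⊗ₜ[K] y) trivial using 1
    have := generatorProduct_mul_ι (K := K) m (Finsupp.single m 1)
    rw [hm.neg_one_pow, neg_one_smul, eq_neg_iff_add_eq_zero, add_comm,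
      ← eq_neg_iff_add_eq_zero] at this
    simp only [Nat.add_sub_cancel, smul_mul_assoc, mul_smul_comm,
      Algebra.TensorProduct.tmul_mul_tmul, ← h, this, ← generatorProduct_succ,
      TensorProduct.neg_tmul, pow_succ, mul_two, add_smul]
    module
  | @anti n b q y hq h ih =>
    obtain ⟨m, hm, hc⟩ := ih
    obtain ⟨n, rfl⟩ := Nat.exists_eq_add_of_le' hc.pos
    have h' : y * q = -(q * y) := by rw [h, neg_neg]
    cases b
    · have hm : Even m := by simpa using hm
      refine ⟨m + 1, by simpa [Nat.odd_add_one] using hm, ?_⟩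
      convert hc.step (s := ExteriorAlgebra.ι K (Finsupp.single m 1) ⊗ₜ[K] y) trivial using 1
      have := generatorProduct_mul_ι (K := K) m (Finsupp.single m 1)
      rw [hm.neg_one_pow, one_smul] at this
      simp only [Nat.add_sub_cancel, smul_mul_assoc, mul_smul_comm,
        Algebra.TensorProduct.tmul_mul_tmul, h', ← this, ← generatorProduct_succ,
        TensorProduct.tmul_neg, pow_succ]
      module
    -- The degree is already odd and must remain so; hence the `E`-factor is `1`.
    · refine ⟨m, hm, ?_⟩
      convert hc.step (s := (1 : GrassmannE K) ⊗ₜ[K] y) trivial using 1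
      simp only [Nat.add_sub_cancel, smul_mul_assoc, mul_smul_comm,
        Algebra.TensorProduct.tmul_mul_tmul, h', TensorProduct.tmul_neg, pow_succ, one_mul,
        mul_one]
      module

theorem CommutatorSequence.not_satisfiesIdentity (h2 : (2 : K) ≠ 0) {n : ℕ} {b : Bool} {q : N}
    (h : CommutatorSequence n b q) (hq : q ≠ 0) :
    ¬ SatisfiesIdentity (GrassmannE K ⊗[K] N) (commutatorPolynomial K n) := by
  obtain ⟨m, -, hc⟩ := h.exists_iteratedCommutator (K := K)
  rw [satisfiesIdentity_commutatorPolynomial_iff hc.pos]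
  intro H
  exact smul_ne_zero (pow_ne_zero _ h2)
    (TensorProduct.tmul_ne_zero_of_field (generatorProduct_ne_zero m) hq) (H _ hc)

variable {κ : Type*} {g : κ → N}

variable (K) in
/-- The element `v₁ ⋯ vᵣ ⊗ g_{k₁} ⋯ g_{kₜ}` of `E ⊗ N`. -/
noncomputable def tensorMonomial (g : κ → N) (l : List (ℕ →₀ K)) (m : List κ) : GrassmannE K ⊗[K] N :=
  (l.map (ExteriorAlgebra.ι K)).prod ⊗ₜ[K] (m.map g).prod

theorem span_tensorMonomial (hgen : Algebra.adjoin K (Set.range g) = ⊤) :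
    Submodule.span K {w | ∃ l m, tensorMonomial K g l m = w} = ⊤ := by
  have h1 := span_range_list_prod (K := K) (N := GrassmannE K)
    (g := (ExteriorAlgebra.ι K : (ℕ →₀ K) → _)) (CliffordAlgebra.adjoin_range_ι)
  have h2 := span_range_list_prod (K := K) hgen
  rw [← TensorProduct.map₂_mk_top_top_eq_top, ← h1, ← h2, Submodule.map₂_span_span]
  congr 1
  ext w
  simp [Set.mem_image2, tensorMonomial]

theorem tensorMonomial_mul (l l' : List (ℕ →₀ K)) (m m' : List κ) :
    tensorMonomial K g l m * tensorMonomial K g l' m' = tensorMonomial K g (l ++ l') (m ++ m') := by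
  simp [tensorMonomial]

/-- Each nonzero commutator of monomials in `E ⊗ N` comes from a commutator sequence in `N`, in
which at least about half of the factors are nontrivial. -/
theorem IteratedCommutator.exists_commutatorSequence (h2 : (2 : K) ≠ 0)
    (hg : ∀ j k, SignCommute (g j) (g k)) {n : ℕ} {w : GrassmannE K ⊗[K] N}
    (h : IteratedCommutator {w | ∃ l m, tensorMonomial K g l m = w} n w) (hw : w ≠ 0) :
    ∃ (c : K) (l : List (ℕ →₀ K)) (m : List κ) (b : Bool), w = c • tensorMonomial K g l m ∧
      (b = false → Even l.length) ∧ CommutatorSequence n b (m.map g).prod ∧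
      n ≤ 2 * m.length + (if b = true then 1 else 2) := by
  induction h with
  | one hs =>
    obtain ⟨l, m, rfl⟩ := hs
    exact ⟨1, l, m, true, by simp, by simp, .one _, by simp⟩
  | @step n w s _ hs ih =>
    have hw0 : w ≠ 0 := by
      rintro rfl
      simp at hw
    obtain ⟨c, l, m, b, rfl, hl, hseq, hlen⟩ := ih hw0
    obtain ⟨l', m', rfl⟩ := hs
    have hcomm := ExteriorAlgebra.list_prod_mul_list_prod (K := K) l l'
    have hg' := SignCommute.list_map_prod hg m m'
    have hne : tensorMonomial K g (l ++ l') (m ++ m') ≠ 0 ∨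
        tensorMonomial K g l' m' * tensorMonomial K g l m ≠ 0 := by
      by_contra! H
      apply hw
      rw [smul_mul_assoc, mul_smul_comm, tensorMonomial_mul, H.1, H.2]
      simp
    -- Only `0` anticommutes with `1` when `2 ≠ 0`, so each anticommuting step consumes a generator.
    have hanti (hQ : (m.map g).prod * (m'.map g).prod = -((m'.map g).prod * (m.map g).prod)) :
        m' ≠ [] := by
      rintro rfl
      have h0 : (2 : K) • (m.map g).prod = 0 := by
        rw [two_smul, add_eq_zero_iff_eq_neg]
        simpa using hQ
      have h0 : (m.map g).prod = 0 := (smul_eq_zero.1 h0).resolve_left h2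
      exact hw0 (by simp [tensorMonomial, h0])
    have hform : (c • tensorMonomial K g l m) * tensorMonomial K g l' m' -
        tensorMonomial K g l' m' * (c • tensorMonomial K g l m) =
        c • (tensorMonomial K g (l ++ l') (m ++ m') -
          tensorMonomial K g l' m' * tensorMonomial K g l m) := by
      rw [smul_mul_assoc, mul_smul_comm, tensorMonomial_mul, smul_sub]
    rw [hform] at hw ⊢
    rcases Nat.even_or_odd (l.length * l'.length) with he | ho
    · rw [he.neg_one_pow, one_smul] at hcomm
      rcases hg' with hQ | hQ
      · refine absurd ?_ hw
        simp only [tensorMonomial, List.map_append, List.prod_append,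
          Algebra.TensorProduct.tmul_mul_tmul, hcomm, hQ, sub_self, smul_zero]
      · refine ⟨c * 2, l ++ l', m ++ m', true, ?_, by simp, ?_, ?_⟩
        · simp only [tensorMonomial, List.map_append, List.prod_append,
            Algebra.TensorProduct.tmul_mul_tmul, hcomm, hQ, TensorProduct.tmul_neg]
          module
        · rw [List.map_append, List.prod_append]
          exact hseq.anti hQ
        · have := List.length_pos_iff.2 (hanti hQ)
          rw [List.length_append]
          split_ifs at hlen ⊢ <;> omega
    · have hpar := Nat.odd_mul.1 ho
      rw [ho.neg_one_pow, neg_one_smul] at hcomm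
      rcases hg' with hQ | hQ
      -- A previous commuting step would have left an even `E`-degree.
      · have hb : b = true := by
          by_contra hb
          exact Nat.not_even_iff_odd.2 hpar.1 (hl (by simpa using hb))
        subst hb
        refine ⟨c * 2, l ++ l', m ++ m', false, ?_, fun _ => ?_, ?_, ?_⟩
        · simp only [tensorMonomial, List.map_append, List.prod_append,
            Algebra.TensorProduct.tmul_mul_tmul, hcomm, hQ, TensorProduct.neg_tmul]
          module
        · rw [List.length_append]
          exact hpar.1.add_odd hpar.2
        · rw [List.map_append, List.prod_append]
          exact hseq.comm hQ
        · rw [List.length_append]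
          simp only [if_true, Bool.false_eq_true, if_false] at hlen ⊢
          omega
      · refine absurd ?_ hw
        simp only [tensorMonomial, List.map_append, List.prod_append,
          Algebra.TensorProduct.tmul_mul_tmul, hcomm, hQ, TensorProduct.neg_tmul,
          TensorProduct.tmul_neg, neg_neg, sub_self, smul_zero]

theorem exists_commutatorSequence_of_not_satisfiesIdentity (h2 : (2 : K) ≠ 0)
    (hg : ∀ j k, SignCommute (g j) (g k)) (hgen : Algebra.adjoin K (Set.range g) = ⊤) {n : ℕ}
    (hn : 1 ≤ n) (h : ¬ SatisfiesIdentity (GrassmannE K ⊗[K] N) (commutatorPolynomial K n)) :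
    ∃ (m : List κ) (b : Bool), (m.map g).prod ≠ 0 ∧ CommutatorSequence n b (m.map g).prod ∧
      n ≤ 2 * m.length + 2 := by
  obtain ⟨w, hw, hw0⟩ := exists_iteratedCommutator_ne_zero (span_tensorMonomial hgen) hn h
  obtain ⟨c, l, m, b, rfl, -, hseq, hlen⟩ := hw.exists_commutatorSequence h2 hg hw0
  refine ⟨m, b, fun h0 => hw0 (by simp [tensorMonomial, h0]), hseq, hlen.trans ?_⟩
  split_ifs <;> omega

theorem not_satisfiesIdentity_succ_of_odd (h2 : (2 : K) ≠ 0)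
    (hg : ∀ j k, SignCommute (g j) (g k)) (hgen : Algebra.adjoin K (Set.range g) = ⊤) {n : ℕ}
    (hn : Odd n) (h : ¬ SatisfiesIdentity (GrassmannE K ⊗[K] N) (commutatorPolynomial K n)) :
    ¬ SatisfiesIdentity (GrassmannE K ⊗[K] N) (commutatorPolynomial K (n + 1)) := by
  obtain ⟨m, b, hne, hseq, -⟩ :=
    exists_commutatorSequence_of_not_satisfiesIdentity h2 hg hgen hn.pos h
  obtain ⟨b', hseq'⟩ := hseq.exists_succ_of_odd hn
  exact hseq'.not_satisfiesIdentity h2 hne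

/-- A nonzero monomial cannot repeat a square-zero generator, so its length is at most `card κ`. -/
theorem satisfiesIdentity_of_card_lt [Fintype κ] (h2 : (2 : K) ≠ 0)
    (hg : ∀ j k, SignCommute (g j) (g k)) (hsq : ∀ k, g k * g k = 0)
    (hgen : Algebra.adjoin K (Set.range g) = ⊤) {n : ℕ} (hn : 2 * Fintype.card κ + 2 < n) :
    SatisfiesIdentity (GrassmannE K ⊗[K] N) (commutatorPolynomial K n) := by
  by_contra h
  obtain ⟨m, b, hne, -, hlen⟩ :=
    exists_commutatorSequence_of_not_satisfiesIdentity h2 hg hgen (by omega) h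
  have := (nodup_of_list_prod_ne_zero hg hsq hne).length_le_card
  omega

end TensorWithGrassmann

/-! ### Generators of the finite tensor product. -/

section PiTensor

theorem PiTensorProduct.iSup_range_singleAlgHom {K ι : Type*} [CommRing K] [Finite ι]
    [DecidableEq ι] {A : ι → Type*} [∀ l, Ring (A l)] [∀ l, Algebra K (A l)] :
    ⨆ l, (PiTensorProduct.singleAlgHom (R := K) (A := A) l).range = ⊤ := by
  set S := ⨆ l, (PiTensorProduct.singleAlgHom (R := K) (A := A) l).range with hS
  rw [← Algebra.toSubmodule_eq_top, ← top_le_iff, ← PiTensorProduct.span_tprod_eq_top,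
    Submodule.span_le]
  rintro _ ⟨x, rfl⟩
  -- A pure tensor is the product of its one-slot tensors.
  have : x ∈ S.toSubmonoid.comap (PiTensorProduct.tprodMonoidHom K (A := A)) :=
    Submonoid.pi_mem_of_mulSingle_mem x fun l =>
      le_iSup (fun l => (PiTensorProduct.singleAlgHom (R := K) (A := A) l).range) l ⟨x l, rfl⟩
  exact this

variable (K : Type*) [Field K] {s : ℕ} (i : Fin s → ℕ)

/-- The standard generators of `E_{i_1} ⊗ ⋯ ⊗ E_{i_s}`. -/
def piGrassmannGenerator (k : Σ l, Fin (i l)) : PiTensorProduct K fun l => GrassmannEr K (i l) :=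
  PiTensorProduct.singleAlgHom (R := K) (A := fun l => GrassmannEr K (i l)) k.1
    (ExteriorAlgebra.ι K (Pi.single k.2 1))

theorem piGrassmannGenerator_mul_self (k : Σ l, Fin (i l)) :
    piGrassmannGenerator K i k * piGrassmannGenerator K i k = 0 := by
  rw [piGrassmannGenerator, ← map_mul, ExteriorAlgebra.ι_sq_zero, map_zero]

theorem signCommute_piGrassmannGenerator (j k : Σ l, Fin (i l)) :
    SignCommute (piGrassmannGenerator K i j) (piGrassmannGenerator K i k) := by
  obtain ⟨l, j⟩ := j
  obtain ⟨l', k⟩ := k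
  by_cases h : l = l'
  · subst h
    right
    simp only [piGrassmannGenerator]
    rw [← map_mul, ExteriorAlgebra.ι_mul_ι_eq_neg, map_neg, map_mul]
  · left
    exact (Pi.mulSingle_commute h _ _).map
      (PiTensorProduct.tprodMonoidHom K (A := fun l => GrassmannEr K (i l)))

theorem adjoin_ι_single (r : ℕ) :
    Algebra.adjoin K (Set.range fun t : Fin r => ExteriorAlgebra.ι K (Pi.single t (1 : K))) =
      (⊤ : Subalgebra K (GrassmannEr K r)) := by
  rw [← top_le_iff, ← CliffordAlgebra.adjoin_range_ι]
  refine Algebra.adjoin_le ?_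
  rintro _ ⟨v, rfl⟩
  change ExteriorAlgebra.ι K v ∈ _
  have hv : v = ∑ t, v t • Pi.single t (1 : K) := by
    ext j
    simp [Pi.single_apply]
  rw [hv, map_sum]
  refine Subalgebra.sum_mem _ fun t _ => ?_
  rw [map_smul]
  exact Subalgebra.smul_mem _ (Algebra.subset_adjoin (Set.mem_range_self t)) _

theorem adjoin_piGrassmannGenerator :
    Algebra.adjoin K (Set.range (piGrassmannGenerator K i)) = ⊤ := by
  rw [← top_le_iff, ← PiTensorProduct.iSup_range_singleAlgHom]
  refine iSup_le fun l => ?_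
  rw [← Algebra.map_top, ← adjoin_ι_single, AlgHom.map_adjoin]
  refine Algebra.adjoin_mono ?_
  rintro _ ⟨_, ⟨t, rfl⟩, rfl⟩
  exact ⟨⟨l, t⟩, rfl⟩

end PiTensor

theorem proposition2p13 (K : Type*) [Field K] (hK2 : ringChar K ≠ 2) (hK3 : ringChar K ≠ 3)
    (s : ℕ) (i : Fin s → ℕ) (hi : ∀ l, 2 ≤ i l) :
    (∀ k : ℕ, 1 ≤ k →
      ¬ SatisfiesIdentity (GrassmannProduct K i) (commutatorPolynomial K (2 * k + 1)) →
      ¬ SatisfiesIdentity (GrassmannProduct K i) (commutatorPolynomial K (2 * k + 2))) ∧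
    ∃ q : ℕ, IsLeast {n : ℕ | 1 ≤ n ∧
        SatisfiesIdentity (GrassmannProduct K i) (commutatorPolynomial K n)} q ∧ Odd q := by
  classical
  have h2 : (2 : K) ≠ 0 := Ring.two_ne_zero hK2
  have hsucc (n : ℕ) (hn : Odd n) :=
    not_satisfiesIdentity_succ_of_odd (n := n) h2 (signCommute_piGrassmannGenerator K i)
      (adjoin_piGrassmannGenerator K i) hn
  refine ⟨fun k _ => hsucc (2 * k + 1) ⟨k, rfl⟩, ?_⟩
  have hex : ∃ n : ℕ, 1 ≤ n ∧
      SatisfiesIdentity (GrassmannProduct K i) (commutatorPolynomial K n) :=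
    ⟨_, by omega, satisfiesIdentity_of_card_lt h2 (signCommute_piGrassmannGenerator K i)
      (piGrassmannGenerator_mul_self K i) (adjoin_piGrassmannGenerator K i) (Nat.lt_succ_self _)⟩
  refine ⟨Nat.find hex, ⟨Nat.find_spec hex, fun n hn => Nat.find_min' hex hn⟩, ?_⟩
  by_contra hodd
  obtain ⟨hpos, hsat⟩ := Nat.find_spec hex
  obtain ⟨n, hn⟩ := Nat.exists_eq_add_of_le' hpos
  -- If the least length `n + 1` were even, the identity would fail at the odd length `n`, hence
  -- also at `n + 1`.
  rw [hn, Nat.odd_add_one, not_not] at hodd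
  rw [hn] at hsat
  exact hsucc n hodd (fun h => Nat.find_min hex (by omega) ⟨hodd.pos, h⟩) hsat
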